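/- **Corollary 6.6.** *Setting.* Write a permutation $\sigma\in\mathfrak S_n$ in one-line notation, as the word $\sigma_1\sigma_2\cdots\sigma_n$. For a word $w$ with distinct letters, $\operatorname{std}(w)$ is the permutation with the same relative order. Consider two graded Hopf algebras: the shuffle algebra, with basis the words, whose product $uv$ is the sum of all interleavings of $u$ and $v$ (with multiplicity) and whose coproduct is deconcatenation $\Delta(w_1\cdots w_n)=\sum_{i=0}^n w_1\cdots w_i\otimes w_{i+1}\cdots w_n$; and the Malvenuto–Reutenauer algebra $\mathbf{FQSym}$, with basis the permutations, whose product $\sigma\tau$ is the sum of all interleavings of $\sigma$ with the word obtained from $\tau$ by adding $\deg\sigma$ to each letter, and whose coproduct is $\Delta(\sigma_1\cdots\sigma_n)=\sum_{i=0}^n \operatorname{std}(\sigma_1\cdots\sigma_i)\otimes\operatorname{std}(\sigma_{i+1}\cdots\sigma_n)$. For a weak-composition $D=(d_1,\dots,d_l)$ of $n$, let $m\Delta_D$ be the $l$-fold iterated coproduct, followed by the projection to degrees $(d_1,\dots,d_l)$, followed by multiplication. For a probability distribution $P$ on weak-compositions of $n$ put $$m\Delta_P=\sum_D \frac{P(D)}{\binom{n}{d_1\,\cdots\,d_l}}\,m\Delta_D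 ,$$ and let $\eta(x)$ be the sum of the coefficients of $\Delta_{1,\dots,1}(x)$, in the basis of tensors of basis elements of degree 1. The chain driven by $m\Delta_P$ is the Markov chain on $\mathfrak S_n$ that moves from $\sigma$ to $\tau$ with probability $\frac{\eta(\tau)}{\eta(\sigma)}$ times the coefficient of $\tau$ in $m\Delta_P(\sigma)$. *Top-to-random* is the distribution $P$ concentrated at $(1,n-1)$. *Binomial-top-to-random* with parameter $q_2\in[0,1]$ is the distribution $P$ that gives probability $\binom nr(1-q_2)^r q_2^{\,n-r}$ to $(1^r,n-r)$, $0\le r\le n$, where $1^r$ denotes $r$ parts equal to $1$ and $1^0$ a single part $0$. The chain "without standardisation" is the one on the shuffle algebra (the usual card shuffle: $\sigma_i$ is the $i$-th card from the top); the chain "with standardisation" is the one on $\mathbf{FQSym}$. *Statement.* Let $n\ge 1$, $0\le j\le n-1$, $1\le k\le n-j$ and $t\ge 0$ be integers. Let $\sigma$ be the state after $t$ steps, starting from the identity permutation, of the top-to-random chain (resp. the binomial-top-to-random chain with parameter $q_2$), with or without standardisation. Put $\beta_j=\frac jn$ (resp. $\beta_j=q_2^{\,n-j}$). Then the probability that the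 smallest value among $\{\sigma_{j+1},\sigma_{j+2},\dots,\sigma_n\}$ is $\sigma_{j+k}$ is $$\begin{cases}\dfrac{1}{n-j}\left(1+\beta_j^{\,t}\,(n-j-1)\right) & \text{if } k=1,\\[2mm] \dfrac{1}{n-j}\left(1-\beta_j^{\,t}\right) & \text{if } k\ne 1,\end{cases}$$ with the convention $0^0=1$. -/

import Mathlib

/-!
The spaces below have a basis of words. A word is a finite list of natural numbers, its degree is
its length, and a permutation `σ` of `{1, …, n}` is the word `σ_1 … σ_n` (one-line notation).
-/

noncomputable section

namespace DescentChain

/-- Words; the leftmost letter is the top card of the deck (the top task of the list). -/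
abbrev Word := List ℕ

/-- The real vector space with basis the words. -/
abbrev WordSpace := Word →₀ ℝ

/-- The direct sum over `l` of the `l`-fold tensor powers of `WordSpace`, in its basis of pure
tensors of words: the list `[w₁, …, w_l]` stands for `w₁ ⊗ ⋯ ⊗ w_l`. -/
abbrev TensorSpace := List Word →₀ ℝ

/-- All interleavings of two words, listed with multiplicity. -/
def interleavings : Word → Word → List Word
  | [], v => [v]
  | a :: u, [] => [a :: u]
  | a :: u, b :: v =>
      (interleavings u (b :: v)).map (List.cons a) ++ (interleavings (a :: u) v).map (List.cons b)

/-- The shuffle of two words: the sum of all their interleavings, with multiplicity. -/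
def shuffle (u v : Word) : WordSpace :=
  ((interleavings u v).map fun w => Finsupp.single w (1 : ℝ)).sum

/-- Standardisation of a word with distinct letters: each letter is replaced by its rank, so that
the result is a permutation of `1, …, length` with the same relative order. -/
def std (w : Word) : Word :=
  w.map fun a => w.countP fun b => decide (b ≤ a)

/-- A product and a coproduct, given on basis words. -/
structure ProductCoproduct where
  /-- the product of two words -/
  mul : Word → Word → WordSpace
  /-- the coproduct of a word; the pair `(u, v)` stands for `u ⊗ v` -/
  comul : Word → (Word × Word →₀ ℝ)

/-- The shuffle algebra: the product is the sum of all interleavings, the coproduct is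
deconcatenation. -/
def shuffleAlgebra : ProductCoproduct where
  mul u v := shuffle u v
  comul w := ∑ i ∈ Finset.range (w.length + 1), Finsupp.single (w.take i, w.drop i) 1

/-- The Malvenuto–Reutenauer Hopf algebra of permutations (free quasisymmetric functions) in its
fundamental basis, which consists of the words that are permutations: to multiply `u` and `v`, add
the degree of `u` to each letter of `v` and sum over all interleavings; the coproduct is
"deconcatenate and standardise". The formulas are written for all words; the permutations span a
subspace that is closed under both operations. -/
def fqSym : ProductCoproduct where
  mul u v := shuffle u (v.map fun a => a + u.length)
  comul w := ∑ i ∈ Finset.range (w.length + 1), Finsupp.single (std (w.take i), std (w.drop i)) 1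

namespace ProductCoproduct

variable (H : ProductCoproduct)

/-- The map `Δ ⊗ id ⊗ ⋯ ⊗ id`, which applies the coproduct to the first tensor factor. -/
def comulFirst : TensorSpace →ₗ[ℝ] TensorSpace :=
  Finsupp.linearCombination ℝ fun ws =>
    match ws with
    | [] => 0
    | w :: ws' => (H.comul w).sum fun uv c => Finsupp.single (uv.1 :: uv.2 :: ws') c

/-- The iterated coproduct `Δ^{[k+1]} = (Δ ⊗ id^{⊗(k-1)}) ∘ ⋯ ∘ (Δ ⊗ id) ∘ Δ`, with values in the
`(k+1)`-fold tensor power. -/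
def iterComul : ℕ → (WordSpace →ₗ[ℝ] TensorSpace)
  | 0 => Finsupp.linearCombination ℝ fun w => Finsupp.single [w] 1
  | k + 1 => H.comulFirst ∘ₗ iterComul k

/-- The projection of the tensor powers to the part of multidegree `D`. -/
def projDegree (D : List ℕ) : TensorSpace →ₗ[ℝ] TensorSpace :=
  Finsupp.linearCombination ℝ fun ws =>
    if ws.map List.length = D then Finsupp.single ws 1 else 0

/-- The refined coproduct `Δ_D` of a weak-composition `D = (d₁, …, d_l)`, `l ≥ 1`: the iterated
coproduct `Δ^{[l]}` followed by the projection to degrees `d₁, …, d_l`. -/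
def refinedComul (D : List ℕ) : WordSpace →ₗ[ℝ] TensorSpace :=
  projDegree D ∘ₗ H.iterComul (D.length - 1)

/-- The product of a list of words. -/
def mulWords : List Word → WordSpace
  | [] => Finsupp.single [] 1
  | w :: ws => (mulWords ws).sum fun v c => c • H.mul w v

/-- The multiplication map `m` of arbitrarily many factors. -/
def mulMany : TensorSpace →ₗ[ℝ] WordSpace :=
  Finsupp.linearCombination ℝ H.mulWords

/-- The composite `m Δ_D`. -/
def mulComul (D : List ℕ) : WordSpace →ₗ[ℝ] WordSpace :=
  H.mulMany ∘ₗ H.refinedComul D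

end ProductCoproduct

/-- The multinomial coefficient `(d₁ + ⋯ + d_l)! / (d₁! ⋯ d_l!)`. -/
def multinomialCoeff (D : List ℕ) : ℝ :=
  (D.sum.factorial : ℝ) / (D.map fun d => (d.factorial : ℝ)).prod

namespace ProductCoproduct

variable (H : ProductCoproduct)

/-- The descent operator `m Δ_P = ∑_D P(D) / binom(n, D) · m Δ_D` of a finitely supported
distribution `P` on weak-compositions. -/
def descentOperator (P : List ℕ →₀ ℝ) : WordSpace →ₗ[ℝ] WordSpace :=
  ∑ D ∈ P.support, (P D / multinomialCoeff D) • H.mulComul D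

/-- The rescaling function: the sum of the coefficients of `Δ_{1,…,1}(w)`. -/
def eta (w : Word) : ℝ :=
  (H.refinedComul (List.replicate w.length 1) (Finsupp.single w 1)).sum fun _ c => c

end ProductCoproduct

/-- One-line notation `σ_1 … σ_n` of a permutation, with letters `1, …, n`. -/
def permWord {n : ℕ} (σ : Equiv.Perm (Fin n)) : Word :=
  List.ofFn fun i => (σ i : ℕ) + 1

/-- The transition matrix, on the permutations of `{1, …, n}`, of the Markov chain driven by
`m Δ_P`: the entry at `(σ, τ)`, the probability of moving from `σ` to `τ`, is
`η(τ) / η(σ)` times the coefficient of `τ` in `m Δ_P (σ)`. -/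
def ProductCoproduct.transition (H : ProductCoproduct) (P : List ℕ →₀ ℝ) (n : ℕ) :
    Matrix (Equiv.Perm (Fin n)) (Equiv.Perm (Fin n)) ℝ :=
  Matrix.of fun σ τ =>
    H.eta (permWord τ) / H.eta (permWord σ) *
      H.descentOperator P (Finsupp.single (permWord σ) 1) (permWord τ)

/-- The weak-composition `(1^r, n - r)`; by convention `1^0` is a single part of size `0`. -/
def onesThenRest (n r : ℕ) : List ℕ :=
  (if r = 0 then [0] else List.replicate r 1) ++ [n - r]

/-- The top-to-random distribution, concentrated at `(1, n - 1)`. -/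
def topToRandom (n : ℕ) : List ℕ →₀ ℝ :=
  Finsupp.single [1, n - 1] 1

/-- The binomial-top-to-random distribution with parameter `q`, which assigns probability
`binom(n, r) (1 - q)^r q^(n - r)` to `(1^r, n - r)` for `0 ≤ r ≤ n`. -/
def binomialTopToRandom (n : ℕ) (q : ℝ) : List ℕ →₀ ℝ :=
  ∑ r ∈ Finset.range (n + 1),
    Finsupp.single (onesThenRest n r) ((n.choose r : ℝ) * (1 - q) ^ r * q ^ (n - r))

/-- The probability that a Markov chain on permutations with transition matrix `K`, started from
the identity permutation, is in the set `E` after `t` steps. -/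
def probAfter {n : ℕ} (K : Matrix (Equiv.Perm (Fin n)) (Equiv.Perm (Fin n)) ℝ) (t : ℕ)
    (E : Set (Equiv.Perm (Fin n))) : ℝ :=
  ∑ σ, E.indicator (fun σ => (K ^ t) 1 σ) σ

/-- The event that the smallest value among `σ_{j+1}, …, σ_n` is the letter at position `p`.
Positions are counted from `0` in `Fin n`, so `σ_{j+1}, …, σ_n` are the letters at the indices
`i ≥ j`. -/
def smallestAt {n : ℕ} (j : ℕ) (p : Fin n) : Set (Equiv.Perm (Fin n)) :=
  {σ | IsLeast (σ '' {i : Fin n | j ≤ (i : ℕ)}) (σ p)}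

/-- The claimed probability, for an eigenvalue `β`, that the smallest of the last `n - j` values
is at position `j + k`. -/
def smallestLaw (n j k t : ℕ) (β : ℝ) : ℝ :=
  if k = 1 then 1 / ((n : ℝ) - j) * (1 + β ^ t * ((n : ℝ) - j - 1))
  else 1 / ((n : ℝ) - j) * (1 - β ^ t)

end DescentChain

end

noncomputable section

namespace DescentChain

/-! Put `N = n - j`. In either algebra the component of the coproduct of a permutation in degrees
`D` is a single tensor, so `η = 1`. The operator `m Δ_{(1^r, n - r)}` cuts off the first `r` letters
and multiplies them back in one at a time. It has `n (n - 1) ⋯ (n - r + 1)` terms, which is exactly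
the multinomial coefficient. These terms come from `insertMins`, which repeatedly inserts a new
smallest letter. In `fqSym` the insertions start from the standardised remainder of `σ`; in the
shuffle algebra they start from the identity word, and the result is relabelled by `σ`.

The core is `sum_insertMins`. Fix `N` of the `N + j` positions of the final word and undo the
insertions from the last one. If the last letter was inserted at one of the `N` positions, it is the
smallest there, and each position is hit equally often. Otherwise (`j` places) the `N` positions
pull back to `N` positions of a word shorter by one, with `j - 1` others. Hence `j (j - 1) ⋯ (j - r
+ 1)` terms give the answer of the starting word, and in the remaining ones the place of the minimum
is uniform. Averaging over `r`, one step turns a probability `x` into `β x + (1 - β) / N`, where `β`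
is the mean of the ratio of the falling factorials of `j` and `n`. The recurrence has fixed point `1
/ N` and rate `β`.

With standardisation this applies to the last step of the chain. Without it the reinserted cards
need not be minimal, but the chain is a left-invariant walk on the group: after `t + 1` steps the
state is `ρ * τ`, with `ρ` the first step from the identity and `τ` an independent `t`-step state.
For fixed `τ`, the event concerns the letters of `ρ` at the positions `τ (j + l)`, and `ρ` arises by
inserting minima into the identity word. -/

/-! ### Sums of words and insertion of new minima -/

/-- The sum of a list of basis words. -/
def wordSum (L : List Word) : WordSpace :=
  (L.map fun w => Finsupp.single w (1 : ℝ)).sum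

theorem wordSum_nil : wordSum [] = 0 := rfl

theorem wordSum_cons (w : Word) (L : List Word) :
    wordSum (w :: L) = Finsupp.single w 1 + wordSum L := by
  simp [wordSum]

theorem wordSum_append (L M : List Word) : wordSum (L ++ M) = wordSum L + wordSum M := by
  simp [wordSum]

theorem wordSum_apply (L : List Word) (w : Word) : wordSum L w = (L.count w : ℝ) := by
  induction L with
  | nil => simp [wordSum_nil]
  | cons v L ih =>
    rw [wordSum_cons, Finsupp.add_apply, ih, List.count_cons, Finsupp.single_apply]
    by_cases h : v = w <;> simp [h, add_comm]

theorem linearCombination_wordSum (f : Word → WordSpace) (L : List Word) :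
    Finsupp.linearCombination ℝ f (wordSum L) = (L.map f).sum := by
  induction L with
  | nil => simp [wordSum_nil]
  | cons v L ih => simp [wordSum_cons, ih]

theorem wordSum_flatMap (L : List Word) (g : Word → List Word) :
    wordSum (L.flatMap g) = (L.map fun v => wordSum (g v)).sum := by
  induction L with
  | nil => simp [wordSum_nil]
  | cons v L ih => simp [wordSum_append, ih]

/-- All words obtained by inserting the letter `a` into `v`. -/
def insertions (a : ℕ) (v : Word) : List Word :=
  (List.range (v.length + 1)).map fun i => v.insertIdx i a

theorem interleavings_singleton (a : ℕ) (v : Word) :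
    interleavings [a] v = insertions a v := by
  induction v with
  | nil => simp [interleavings, insertions]
  | cons b v ih =>
    rw [interleavings, ih, insertions, insertions, List.length_cons,
      List.range_succ_eq_map (n := v.length + 1)]
    simp [interleavings, Function.comp_def]

theorem interleavings_nil_right (u : Word) : interleavings u [] = [u] := by
  cases u <;> simp [interleavings]

theorem map_insertions (f : ℕ → ℕ) (a : ℕ) (v : Word) :
    (insertions a v).map (List.map f) = insertions (f a) (v.map f) := by
  simp [insertions, Function.comp_def, List.map_insertIdx]

/-- The words obtained from `v` by inserting `r` times a new smallest letter `1`, the other letters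
being raised by `1` each time. -/
def insertMins : ℕ → Word → List Word
  | 0, v => [v]
  | r + 1, v => (insertMins r v).flatMap fun w => insertions 1 (w.map (· + 1))

theorem length_of_mem_insertMins {r : ℕ} {v w : Word} (h : w ∈ insertMins r v) :
    w.length = v.length + r := by
  induction r generalizing w with
  | zero => simp_all [insertMins]
  | succ r ih =>
    simp only [insertMins, List.mem_flatMap, insertions, List.mem_map, List.mem_range] at h
    obtain ⟨u, hu, i, hi, rfl⟩ := h
    rw [List.length_insertIdx_of_le_length (by omega), List.length_map, ih hu]
    omega

theorem perm_of_mem_insertMins {r m : ℕ} {v w : Word} (hv : v.Perm (List.range' 1 m))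
    (h : w ∈ insertMins r v) : w.Perm (List.range' 1 (m + r)) := by
  induction r generalizing w with
  | zero => simp_all [insertMins]
  | succ r ih =>
    simp only [insertMins, List.mem_flatMap, insertions, List.mem_map, List.mem_range] at h
    obtain ⟨u, hu, i, hi, rfl⟩ := h
    refine (List.perm_insertIdx _ _ (by omega)).trans ?_
    rw [← add_assoc, List.range'_succ]
    refine List.Perm.cons _ ?_
    have := (ih hu).map (1 + ·)
    rw [List.map_add_range'] at this
    simpa only [add_comm] using this

theorem length_insertMins (r : ℕ) (v : Word) :
    (insertMins r v).length = (v.length + r).descFactorial r := by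
  induction r with
  | zero => simp [insertMins]
  | succ r ih =>
    have : ∀ w ∈ insertMins r v, (insertions 1 (w.map (· + 1))).length = v.length + r + 1 := by
      intro w hw
      simp [insertions, length_of_mem_insertMins hw]
    rw [insertMins, List.length_flatMap, List.map_congr_left this, ← add_assoc,
      Nat.succ_descFactorial_succ]
    simp [ih, mul_comm]

/-! ### Multiplication by the empty word and by a letter -/

namespace ProductCoproduct

variable {H : ProductCoproduct}

theorem mulWords_singleton {sh : ℕ → Word → Word}
    (hmul : ∀ u v, H.mul u v = shuffle u (sh u.length v)) (hsh : ∀ m, sh m [] = []) (w : Word) :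
    H.mulWords [w] = wordSum [w] := by
  simp [mulWords, hmul, hsh, shuffle, interleavings_nil_right, wordSum]

theorem mulWords_nil_cons {sh : ℕ → Word → Word}
    (hmul : ∀ u v, H.mul u v = shuffle u (sh u.length v)) (hsh : ∀ v, sh 0 v = v)
    {ws : List Word} {L : List Word} (h : H.mulWords ws = wordSum L) :
    H.mulWords ([] :: ws) = wordSum L := by
  have : H.mulWords ([] :: ws) = Finsupp.linearCombination ℝ (H.mul []) (H.mulWords ws) := rfl
  rw [this, h, linearCombination_wordSum, wordSum]
  congr 2
  funext v
  simp [hmul, hsh, shuffle, interleavings]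

theorem mulWords_letter_cons {sh : ℕ → Word → Word}
    (hmul : ∀ u v, H.mul u v = shuffle u (sh u.length v))
    {ws : List Word} {L : List Word} (h : H.mulWords ws = wordSum L) (a : ℕ) :
    H.mulWords ([a] :: ws) = wordSum (L.flatMap fun v => insertions a (sh 1 v)) := by
  have : H.mulWords ([a] :: ws) = Finsupp.linearCombination ℝ (H.mul [a]) (H.mulWords ws) := rfl
  rw [this, h, linearCombination_wordSum, wordSum_flatMap]
  congr 2
  funext v
  simp [hmul, shuffle, interleavings_singleton, wordSum]

end ProductCoproduct

/-! ### Standardisation -/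

theorem std_map {f : ℕ → ℕ} {w : Word} (hf : ∀ a ∈ w, ∀ b ∈ w, f a ≤ f b ↔ a ≤ b) :
    std (w.map f) = std w := by
  rw [std, std, List.map_map]
  refine List.map_congr_left fun a ha => ?_
  rw [Function.comp, List.countP_map]
  refine List.countP_congr fun b hb => ?_
  simp [hf b hb a ha]

/-- If `b < a`, the letter `a` itself is counted in the rank of `a` but not in that of `b`, so the
ranks differ strictly. -/
theorem rank_le_rank_iff {w : Word} {a b : ℕ} (ha : a ∈ w) :
    (w.countP fun c => decide (c ≤ a)) ≤ (w.countP fun c => decide (c ≤ b)) ↔ a ≤ b := by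
  constructor
  · intro h
    by_contra! hba
    have : (w.countP fun c => decide (c ≤ b)) < (w.countP fun c => decide (c ≤ a)) := by
      induction w with
      | nil => simp at ha
      | cons c w ih =>
        have hmono : (w.countP fun c => decide (c ≤ b)) ≤ (w.countP fun c => decide (c ≤ a)) :=
          List.countP_mono_left fun x _ hx => by simp at hx ⊢; omega
        by_cases hc : a ∈ w
        · have := ih hc
          simp only [List.countP_cons] at h ⊢
          by_cases h1 : c ≤ b
          · have h2 : c ≤ a := by omega
            have := this (by simp [h1, h2] at h; omega)
            simp [h1, h2]; omega
          · by_cases h2 : w.countP (fun c => decide (c ≤ a)) ≤ w.countP fun c => decide (c ≤ b)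
            · have := this h2; omega
            · simp [h1]; omega
        · obtain rfl : a = c := by simpa [hc] using ha
          simp [show ¬ a ≤ b by omega]; omega
    omega
  · intro h
    exact List.countP_mono_left fun x _ hx => by simp at hx ⊢; omega

theorem length_std (w : Word) : (std w).length = w.length := by simp [std]

/-- Passing to ranks preserves the relative order, hence also that of a prefix. This makes repeated
standardisation in the iterated coproduct collapse to a single one. -/
theorem std_take_std (w : Word) (i : ℕ) : std ((std w).take i) = std (w.take i) := by
  conv_lhs => rw [std.eq_def w, ← List.map_take]
  exact std_map fun a ha b _ => rank_le_rank_iff (List.mem_of_mem_take ha)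

theorem std_drop_std (w : Word) (i : ℕ) : std ((std w).drop i) = std (w.drop i) := by
  conv_lhs => rw [std.eq_def w, ← List.map_drop]
  exact std_map fun a ha b _ => rank_le_rank_iff (List.mem_of_mem_drop ha)

theorem std_perm {w : Word} (hw : w.Nodup) : (std w).Perm (List.range' 1 w.length) := by
  have hnd : (std w).Nodup := by
    refine hw.map_on fun a ha b hb h => ?_
    exact le_antisymm ((rank_le_rank_iff ha).1 h.le) ((rank_le_rank_iff hb).1 h.ge)
  refine (hnd.subperm fun x hx => ?_).perm_of_length_le (by simp [length_std])
  simp only [std, List.mem_map] at hx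
  obtain ⟨a, ha, rfl⟩ := hx
  have h1 : 0 < w.countP fun b => decide (b ≤ a) := List.countP_pos_iff.2 ⟨a, ha, by simp⟩
  have h2 : (w.countP fun b => decide (b ≤ a)) ≤ w.length := List.countP_le_length
  simp only [List.mem_range'_1]
  omega

theorem countP_le_range' (n x : ℕ) (hx : x ≤ n) :
    ((List.range' 1 n).countP fun b => decide (b ≤ x)) = x := by
  induction n with
  | zero => simp at hx; simp [hx]
  | succ n ih =>
    rw [List.range'_concat, List.countP_append]
    rcases Nat.lt_or_ge n x with h | h
    · obtain rfl : x = n + 1 := by omega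
      have : ((List.range' 1 n).countP fun b => decide (b ≤ n + 1)) = (List.range' 1 n).length := by
        rw [List.countP_eq_length]
        intro a ha
        simp only [List.mem_range'_1] at ha
        simp; omega
      simp [this, add_comm]
    · rw [ih h]; simp; omega

theorem std_eq_self {n : ℕ} {w : Word} (hw : w.Perm (List.range' 1 n)) : std w = w := by
  conv_rhs => rw [← List.map_id w]
  refine List.map_congr_left fun a ha => ?_
  have := hw.mem_iff.1 ha
  simp only [List.mem_range'_1] at this
  rw [hw.countP_eq, countP_le_range' n a (by omega), id]

/-! ### Refined coproducts of a basis word -/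

/-- The factors of lengths `D` of a word, each transformed by `st`. -/
def factors (st : Word → Word) : List ℕ → Word → List Word
  | [], _ => []
  | d :: D, w => st (w.take d) :: factors st D (w.drop d)

theorem map_length_factors {st : Word → Word} (hlen : ∀ w, (st w).length = w.length)
    (D : List ℕ) (w : Word) (h : D.sum ≤ w.length) : (factors st D w).map List.length = D := by
  induction D generalizing w with
  | nil => rfl
  | cons d D ih =>
    simp only [List.sum_cons] at h
    simp only [factors, List.map_cons, hlen, List.length_take]
    rw [ih _ (by simp; omega), min_eq_left (by omega)]

namespace ProductCoproduct

variable {H : ProductCoproduct} {st : Word → Word}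

theorem comulFirst_single_cons
    (hco : ∀ w, H.comul w = ∑ i ∈ Finset.range (w.length + 1),
      Finsupp.single (st (w.take i), st (w.drop i)) 1) (w : Word) (ws : List Word) :
    H.comulFirst (Finsupp.single (w :: ws) 1) =
      ∑ i ∈ Finset.range (w.length + 1),
        Finsupp.single (st (w.take i) :: st (w.drop i) :: ws) 1 := by
  rw [comulFirst, Finsupp.linearCombination_single, one_smul]
  change (H.comul w).sum (fun uv c => Finsupp.single (uv.1 :: uv.2 :: ws) c) = _
  rw [hco, ← Finsupp.sum_finsetSum_index (by simp) (by simp)]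
  simp

theorem projDegree_single (D : List ℕ) (ws : List Word) :
    projDegree D (Finsupp.single ws 1) =
      if ws.map List.length = D then Finsupp.single ws 1 else 0 := by
  simp [projDegree]

/-- The two pieces of a first factor have lengths adding up to its length, so only the part of
degree `(d + e) :: D` can reach degree `d :: e :: D`. The projection can thus be made before the
last coproduct. -/
theorem projDegree_comulFirst (hlen : ∀ w, (st w).length = w.length)
    (hco : ∀ w, H.comul w = ∑ i ∈ Finset.range (w.length + 1),
      Finsupp.single (st (w.take i), st (w.drop i)) 1) (d e : ℕ) (D : List ℕ) :
    projDegree (d :: e :: D) ∘ₗ H.comulFirst =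
      projDegree (d :: e :: D) ∘ₗ H.comulFirst ∘ₗ projDegree ((d + e) :: D) := by
  refine Finsupp.lhom_ext' fun ws => LinearMap.ext_ring ?_
  simp only [LinearMap.comp_apply, Finsupp.lsingle_apply, projDegree_single ((d + e) :: D)]
  split_ifs with h
  · rfl
  · rw [map_zero, map_zero]
    cases ws with
    | nil => simp [comulFirst]
    | cons w ws =>
      rw [comulFirst_single_cons hco, map_sum]
      refine Finset.sum_eq_zero fun i hi => ?_
      rw [projDegree_single, if_neg]
      contrapose! h
      simp only [List.map_cons, hlen, List.length_take, List.length_drop, List.cons.injEq,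
        Finset.mem_range] at h hi ⊢
      exact ⟨by omega, h.2.2⟩

/-- At each stage only one cut has the prescribed lengths, so a single tensor survives. The map `st`
is the identity for the shuffle algebra and `std` for `fqSym`; `htake` and `hdrop` say that
transforming before cutting again has no effect. -/
theorem refinedComul_single (hlen : ∀ w, (st w).length = w.length)
    (htake : ∀ w i, st ((st w).take i) = st (w.take i))
    (hdrop : ∀ w i, st ((st w).drop i) = st (w.drop i))
    (hco : ∀ w, H.comul w = ∑ i ∈ Finset.range (w.length + 1),
      Finsupp.single (st (w.take i), st (w.drop i)) 1)
    {w : Word} (hw : st w = w) (D : List ℕ) (d : ℕ) (hD : (d :: D).sum = w.length) :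
    H.refinedComul (d :: D) (Finsupp.single w 1) =
      Finsupp.single (factors st (d :: D) w) 1 := by
  induction D generalizing d with
  | nil =>
    simp only [List.sum_cons, List.sum_nil, add_zero] at hD
    simp [refinedComul, iterComul, projDegree_single, factors, hD, hw]
  | cons e D ih =>
    have hstep : H.refinedComul (d :: e :: D) =
        projDegree (d :: e :: D) ∘ₗ H.comulFirst ∘ₗ H.refinedComul ((d + e) :: D) := by
      simp only [refinedComul, List.length_cons, Nat.add_sub_cancel, iterComul]
      rw [← LinearMap.comp_assoc, projDegree_comulFirst hlen hco]
      simp only [LinearMap.comp_assoc]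
    simp only [List.sum_cons] at hD
    rw [hstep, LinearMap.comp_apply, LinearMap.comp_apply, ih (d + e) (by simp; omega), factors,
      comulFirst_single_cons hco, map_sum, Finset.sum_eq_single d]
    · rw [projDegree_single, htake, hdrop, List.take_take, List.drop_take,
        min_eq_left (by omega), Nat.add_sub_cancel_left, ← List.drop_drop]
      have hlenD := map_length_factors hlen (d :: e :: D) w (by simp only [List.sum_cons]; omega)
      exact if_pos hlenD
    · intro i hi hid
      rw [projDegree_single, if_neg]
      simp only [Finset.mem_range, hlen, List.length_take] at hi
      simp only [List.map_cons, hlen, List.length_take, List.cons.injEq, not_and]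
      omega
    · intro h
      simp [hlen] at h
      omega

end ProductCoproduct

/-! ### Position of the smallest letter under insertions -/

/-- The indicator that, among the letters of `w` at the positions `p l`, the one at `p k` is
smallest. -/
def minAt {N : ℕ} (p : Fin N → ℕ) (k : Fin N) (w : Word) : ℝ :=
  if ∀ l, w.getD (p k) 0 ≤ w.getD (p l) 0 then 1 else 0

/-- The positions `p` after the removal of the letter at position `i`. -/
def shiftPos {N : ℕ} (i : ℕ) (p : Fin N → ℕ) : Fin N → ℕ :=
  fun l => if p l < i then p l else p l - 1

theorem minAt_map {N : ℕ} {p : Fin N → ℕ} {w : Word} (hp : ∀ l, p l < w.length) (k : Fin N)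
    {f : ℕ → ℕ} (hf : ∀ a ∈ w, ∀ b ∈ w, f a ≤ f b ↔ a ≤ b) :
    minAt p k (w.map f) = minAt p k w := by
  have : ∀ l, (w.map f).getD (p l) 0 = f (w.getD (p l) 0) := fun l => by
    simp [hp l]
  unfold minAt
  refine if_congr (forall_congr' fun l => ?_) rfl rfl
  rw [this, this]
  have hmem : ∀ l, w.getD (p l) 0 ∈ w := fun l => by
    rw [List.getD_eq_getElem _ _ (hp l)]; exact List.getElem_mem _
  exact hf _ (hmem k) _ (hmem l)

theorem getD_insertIdx (w : Word) (i a x : ℕ) (hi : i ≤ w.length) :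
    (w.insertIdx i a).getD x 0 =
      if x < i then w.getD x 0 else if x = i then a else w.getD (x - 1) 0 := by
  simp only [List.getD_eq_getElem?_getD, List.getElem?_insertIdx]
  split_ifs <;> first | rfl | omega

theorem minAt_insertIdx_of_eq {N : ℕ} {p : Fin N → ℕ} (hinj : Function.Injective p) (k l : Fin N)
    {w : Word} (hp : ∀ l, p l < w.length + 1) (hw : ∀ a ∈ w, 2 ≤ a) :
    minAt p k (w.insertIdx (p l) 1) = if k = l then 1 else 0 := by
  have hi : p l ≤ w.length := by have := hp l; omega
  have hval : ∀ m, m ≠ l → 2 ≤ (w.insertIdx (p l) 1).getD (p m) 0 := fun m hm => by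
    have hne : p m ≠ p l := fun h => hm (hinj h)
    have := hp m
    rw [getD_insertIdx _ _ _ _ hi, if_neg hne]
    split_ifs
    · rw [List.getD_eq_getElem _ _ (by omega)]; exact hw _ (List.getElem_mem _)
    · rw [List.getD_eq_getElem _ _ (by omega)]; exact hw _ (List.getElem_mem _)
  have hl : (w.insertIdx (p l) 1).getD (p l) 0 = 1 := by
    rw [getD_insertIdx _ _ _ _ hi, if_neg (lt_irrefl _), if_pos rfl]
  unfold minAt
  refine if_congr ⟨fun h => ?_, ?_⟩ rfl rfl
  · by_contra hk
    have h1 := hval k hk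
    have h2 := h l
    omega
  · rintro rfl m
    by_cases hm : m = k
    · rw [hm]
    · have := hval m hm
      omega

theorem minAt_insertIdx_of_ne {N : ℕ} {p : Fin N → ℕ} (k : Fin N) {i : ℕ} {w : Word} (a : ℕ)
    (hi : i ≤ w.length) (hne : ∀ l, p l ≠ i) :
    minAt p k (w.insertIdx i a) = minAt (shiftPos i p) k w := by
  have : ∀ l, (w.insertIdx i a).getD (p l) 0 = w.getD (shiftPos i p l) 0 := fun l => by
    rw [getD_insertIdx _ _ _ _ hi, if_neg (hne l), shiftPos]
    split_ifs <;> rfl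
  simp only [minAt, this]

theorem list_sum_range (m : ℕ) (f : ℕ → ℝ) :
    ((List.range m).map f).sum = ∑ i ∈ Finset.range m, f i := by
  induction m with
  | zero => simp
  | succ m ih => simp [List.range_succ, Finset.sum_range_succ, ih]

/-- Among the insertion places in the image of `p`, only `p k` makes the letter at `p k` the
smallest, which gives the summand `1`. Any other place merely displaces the positions. -/
theorem sum_insertions {N : ℕ} {p : Fin N → ℕ} (hinj : Function.Injective p) (k : Fin N)
    {w : Word} (hp : ∀ l, p l < w.length + 1) (hw : ∀ a ∈ w, 1 ≤ a) :
    ((insertions 1 (w.map (· + 1))).map (minAt p k)).sum =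
      1 + ∑ i ∈ Finset.range (w.length + 1) \ Finset.univ.image p, minAt (shiftPos i p) k w := by
  have hsub : Finset.univ.image p ⊆ Finset.range (w.length + 1) := by
    intro x hx
    obtain ⟨l, -, rfl⟩ := Finset.mem_image.1 hx
    exact Finset.mem_range.2 (hp l)
  rw [insertions, List.map_map, List.length_map, list_sum_range, ← Finset.sum_sdiff hsub, add_comm]
  congr 1
  · rw [Finset.sum_image fun a _ b _ h => hinj h]
    have : ∀ l, (minAt p k ∘ fun i => (w.map (· + 1)).insertIdx i 1) (p l) =
        if k = l then 1 else 0 := fun l =>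
      minAt_insertIdx_of_eq hinj k l (by simpa using hp) (by simpa using hw)
    rw [Finset.sum_congr rfl fun l _ => this l]
    simp
  · refine Finset.sum_congr rfl fun i hi => ?_
    simp only [Finset.mem_sdiff, Finset.mem_range, Finset.mem_image, Finset.mem_univ, true_and,
      not_exists] at hi
    rw [Function.comp, minAt_insertIdx_of_ne k 1 (by simp; omega) hi.2]
    refine minAt_map (fun l => ?_) k (by simp)
    have := hp l
    have := hi.2 l
    unfold shiftPos
    split_ifs <;> omega

theorem shiftPos_injective {N : ℕ} {p : Fin N → ℕ} (hinj : Function.Injective p) {i : ℕ}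
    (hne : ∀ l, p l ≠ i) : Function.Injective (shiftPos i p) := by
  intro a b h
  have ha := hne a
  have hb := hne b
  refine hinj ?_
  unfold shiftPos at h
  split_ifs at h <;> omega

theorem sum_map_flatMap (L : List Word) (g : Word → List Word) (f : Word → ℝ) :
    ((L.flatMap g).map f).sum = (L.map fun w => ((g w).map f).sum).sum := by
  induction L with
  | nil => simp
  | cons a L ih => simp [ih]

theorem list_sum_map_add (L : List Word) (f g : Word → ℝ) :
    (L.map fun w => f w + g w).sum = (L.map f).sum + (L.map g).sum := by
  induction L with
  | nil => simp
  | cons a L ih => simp [ih]; ring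

theorem list_sum_map_finset_sum (L : List Word) (s : Finset ℕ) (f : ℕ → Word → ℝ) :
    (L.map fun w => ∑ i ∈ s, f i w).sum = ∑ i ∈ s, (L.map (f i)).sum := by
  induction L with
  | nil => simp
  | cons a L ih => simp [ih, Finset.sum_add_distrib]

/-- After `r` insertions of new minima, the letter at `p k` is the smallest of those at the `N`
positions `p l` as often as if either no position was hit (and the answer is that for `v`), or the
place of the minimum was uniform. -/
theorem sum_insertMins {N m : ℕ} {v : Word} (hv : v.Perm (List.range' 1 m)) (k : Fin N) (c : ℝ)
    (Q : ℕ → (Fin N → ℕ) → Prop)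
    (hQ : ∀ m p i, Q (m + 1) p → i ≤ m → (∀ l, p l ≠ i) → Q m (shiftPos i p))
    (hc : ∀ p, Q m p → minAt p k v = c) (r j : ℕ) (hj : m + r = N + j) (p : Fin N → ℕ)
    (hinj : Function.Injective p) (hp : ∀ l, p l < m + r) (hp' : Q (m + r) p) :
    ((insertMins r v).map (minAt p k)).sum =
      (j.descFactorial r : ℝ) * c +
        (((m + r).descFactorial r : ℝ) - j.descFactorial r) / N := by
  have hN : (N : ℝ) ≠ 0 := by
    have := k.pos
    positivity
  have hlen : v.length = m := by simpa using hv.length_eq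
  induction r generalizing j p with
  | zero => simp [insertMins, hc p hp']
  | succ r ih =>
    have hw : ∀ w ∈ insertMins r v,
        ((insertions 1 (w.map (· + 1))).map (minAt p k)).sum =
          1 + ∑ i ∈ Finset.range (m + r + 1) \ Finset.univ.image p, minAt (shiftPos i p) k w := by
      intro w hw
      have hl := length_of_mem_insertMins hw
      rw [hlen] at hl
      rw [sum_insertions hinj k (by rw [hl]; exact hp), hl]
      intro a ha
      have := (perm_of_mem_insertMins hv hw).mem_iff.1 ha
      simp only [List.mem_range'_1] at this
      exact this.1
    rw [insertMins, sum_map_flatMap, List.map_congr_left hw,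
      list_sum_map_add, list_sum_map_finset_sum]
    -- Once the last insertion, at `i`, avoids all positions, the induction hypothesis applies to
    -- the pulled-back positions with one fewer free place.
    have hterm : ∀ i ∈ Finset.range (m + r + 1) \ Finset.univ.image p,
        ((insertMins r v).map (minAt (shiftPos i p) k)).sum =
          ((j - 1).descFactorial r : ℝ) * c +
            (((m + r).descFactorial r : ℝ) - (j - 1).descFactorial r) / N := by
      intro i hi
      simp only [Finset.mem_sdiff, Finset.mem_range, Finset.mem_image, Finset.mem_univ, true_and,
        not_exists] at hi
      have hinj' := shiftPos_injective hinj hi.2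
      have hp1 : ∀ l, shiftPos i p l < m + r := fun l => by
        have := hp l
        have := hi.2 l
        unfold shiftPos
        split_ifs <;> omega
      -- `N` distinct positions fit into length `m + r`, which forces `1 ≤ j`; so the truncated `j -
      -- 1` is a genuine predecessor whenever an avoided place exists.
      have hcard : N ≤ m + r := by
        have := Finset.card_le_card_of_injOn (s := (Finset.univ : Finset (Fin N)))
          (t := Finset.range (m + r)) (shiftPos i p) (fun l _ => by simpa using hp1 l)
          hinj'.injOn
        simpa using this
      exact ih (j - 1) (by omega) _ hinj' hp1 (hQ _ _ _ hp' (by omega) hi.2)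
    rw [Finset.sum_congr rfl hterm, Finset.sum_const, Finset.card_sdiff_of_subset,
      Finset.card_image_of_injective _ hinj]
    · have hcard : (Finset.range (m + r + 1)).card - (Finset.univ : Finset (Fin N)).card = j := by
        simp; omega
      rw [hcard, nsmul_eq_mul]
      simp only [List.map_const', List.sum_replicate, length_insertMins, hlen, nsmul_eq_mul,
        mul_one]
      rw [← add_assoc, Nat.succ_descFactorial_succ]
      have hnj : ((m + r + 1 : ℕ) : ℝ) = N + j := by exact_mod_cast hj
      cases j with
      | zero =>
        push_cast at hnj ⊢
        rw [hnj]
        simp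
        field_simp
      | succ j =>
        rw [Nat.succ_descFactorial_succ, Nat.cast_mul (m + r + 1), hnj]
        push_cast
        field_simp
        ring
    · intro x hx
      obtain ⟨l, -, rfl⟩ := Finset.mem_image.1 hx
      exact Finset.mem_range.2 (hp l)

/-! ### Products of the factors as insertions of minima -/

/-- The relabelling `f` is kept arbitrary for the induction: removing the first letter replaces it
by `fun x => f (x + 1)`, which is the raising of letters in `insertMins`. Inserting `f 1` is then
inserting a new minimum before relabelling. -/
theorem shuffleAlgebra_mulWords_factors (r m : ℕ) (f : ℕ → ℕ) :
    shuffleAlgebra.mulWords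
        (factors id (List.replicate r 1 ++ [m]) ((List.range' 1 (m + r)).map f)) =
      wordSum ((insertMins r (List.range' 1 m)).map (List.map f)) := by
  induction r generalizing f with
  | zero =>
    simp only [List.replicate_zero, List.nil_append, factors, id, add_zero, insertMins,
      List.map_cons, List.map_nil]
    rw [List.take_of_length_le (by simp)]
    exact ProductCoproduct.mulWords_singleton (sh := fun _ v => v) (fun _ _ => rfl)
      (fun _ => rfl) _
  | succ r ih =>
    have hsplit : (List.range' 1 (m + (r + 1))).map f =
        f 1 :: (List.range' 1 (m + r)).map (fun x => f (x + 1)) := by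
      rw [← add_assoc, List.range'_succ, List.map_cons]
      have : (List.range' 1 (m + r)).map (1 + ·) = List.range' (1 + 1) (m + r) :=
        List.map_add_range' ..
      rw [← this, List.map_map]
      simp [Function.comp_def, add_comm]
    rw [hsplit, List.replicate_succ, List.cons_append, factors]
    simp only [List.take_succ_cons, List.take_zero, List.drop_succ_cons, List.drop_zero, id]
    rw [ProductCoproduct.mulWords_letter_cons (sh := fun _ v => v) (fun _ _ => rfl) (ih _)]
    congr 1
    simp only [insertMins, List.map_flatMap, List.flatMap_map, map_insertions, List.map_map]
    rfl

/-- Each one-letter factor standardises to `1`, and the product raises the other word by the degree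
`1`, so every multiplication inserts a new minimum. -/
theorem fqSym_mulWords_factors (r m : ℕ) (w : Word) (hw : w.length = m + r) :
    fqSym.mulWords (factors std (List.replicate r 1 ++ [m]) w) =
      wordSum (insertMins r (std (w.drop r))) := by
  induction r generalizing w with
  | zero =>
    simp only [List.replicate_zero, List.nil_append, factors, insertMins, List.drop_zero]
    rw [List.take_of_length_le (by omega)]
    exact ProductCoproduct.mulWords_singleton (sh := fun s v => v.map (· + s)) (fun _ _ => rfl)
      (fun _ => rfl) _
  | succ r ih =>
    cases w with
    | nil => simp at hw
    | cons a w =>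
      rw [List.replicate_succ, List.cons_append, factors]
      simp only [List.take_succ_cons, List.take_zero, List.drop_succ_cons, List.drop_zero]
      have hstd : std [a] = [1] := by simp [std]
      rw [hstd, ProductCoproduct.mulWords_letter_cons (sh := fun s v => v.map (· + s))
        (fun _ _ => rfl) (ih w (by simp at hw; omega))]
      rfl

/-! ### Permutations as words -/

theorem length_permWord {n : ℕ} (σ : Equiv.Perm (Fin n)) : (permWord σ).length = n := by
  simp [permWord]

theorem permWord_getD {n : ℕ} (σ : Equiv.Perm (Fin n)) (i : Fin n) :
    (permWord σ).getD i 0 = (σ i : ℕ) + 1 := by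
  simp [permWord]

theorem permWord_injective {n : ℕ} :
    Function.Injective (permWord : Equiv.Perm (Fin n) → Word) := by
  intro σ τ h
  ext i
  have h1 := permWord_getD σ i
  rw [h, permWord_getD] at h1
  omega

theorem permWord_perm {n : ℕ} (σ : Equiv.Perm (Fin n)) :
    (permWord σ).Perm (List.range' 1 n) := by
  have hnd : (permWord σ).Nodup := by
    refine List.nodup_ofFn.2 fun i j h => σ.injective (Fin.ext ?_)
    simpa using h
  refine (hnd.subperm fun x hx => ?_).perm_of_length_le (by simp [length_permWord])
  simp only [permWord, List.mem_ofFn] at hx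
  obtain ⟨i, rfl⟩ := hx
  simp only [List.mem_range'_1]
  omega

theorem exists_permWord_eq {n : ℕ} {w : Word} (hw : w.Perm (List.range' 1 n)) :
    ∃ σ : Equiv.Perm (Fin n), permWord σ = w := by
  have hlen : w.length = n := by simpa using hw.length_eq
  have hnd : w.Nodup := hw.nodup_iff.2 List.nodup_range'
  have hmem : ∀ i : Fin n, 1 ≤ w[i] ∧ w[i] < 1 + n := fun i => by
    have := hw.mem_iff.1 (List.getElem_mem (l := w) (n := i) (by omega))
    rw [List.mem_range'_1] at this
    exact this
  let f : Fin n → Fin n := fun i => ⟨w[i] - 1, by have := hmem i; omega⟩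
  have hf : Function.Injective f := by
    intro i j h
    have h1 := hmem i
    have h2 := hmem j
    simp only [f, Fin.mk.injEq] at h
    have h3 : w[i] = w[j] := by omega
    exact Fin.ext ((hnd.getElem_inj_iff).1 h3)
  refine ⟨Equiv.ofBijective f (Finite.injective_iff_bijective.1 hf), ?_⟩
  refine List.ext_getElem (by simp [length_permWord, hlen]) fun i h1 h2 => ?_
  have := (hmem ⟨i, by omega⟩).1
  simp [permWord, f] at this ⊢
  omega

theorem permWord_mul {n : ℕ} (σ τ : Equiv.Perm (Fin n)) :
    (permWord τ).map (fun x => (permWord σ).getD (x - 1) 0) = permWord (σ * τ) := by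
  conv_lhs => rw [permWord.eq_def τ, List.map_ofFn]
  conv_rhs => rw [permWord]
  congr 1
  funext i
  simp only [Function.comp, Nat.add_sub_cancel, permWord_getD, Equiv.Perm.mul_apply]

theorem permWord_one (n : ℕ) : permWord (1 : Equiv.Perm (Fin n)) = List.range' 1 n := by
  refine List.ext_getElem (by simp [length_permWord]) fun i h1 h2 => ?_
  simp [permWord, add_comm]

theorem permWord_eq_map {n : ℕ} (σ : Equiv.Perm (Fin n)) :
    permWord σ = (List.range' 1 n).map (fun x => (permWord σ).getD (x - 1) 0) := by
  rw [← permWord_one, permWord_mul, mul_one]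

theorem sum_count_permWord {n : ℕ} (L : List Word) (hL : ∀ w ∈ L, w.Perm (List.range' 1 n))
    (f : Word → ℝ) :
    ∑ τ : Equiv.Perm (Fin n), (L.count (permWord τ) : ℝ) * f (permWord τ) = (L.map f).sum := by
  induction L with
  | nil => simp
  | cons w L ih =>
    obtain ⟨σ, rfl⟩ := exists_permWord_eq (hL w (by simp))
    have : ∀ τ : Equiv.Perm (Fin n),
        ((permWord σ :: L).count (permWord τ) : ℝ) * f (permWord τ) =
          (L.count (permWord τ) : ℝ) * f (permWord τ) +
            if σ = τ then f (permWord τ) else 0 := fun τ => by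
      rw [List.count_cons]
      by_cases h : σ = τ
      · simp [h]; ring
      · simp [h, permWord_injective.ne h]
    simp only [this, Finset.sum_add_distrib, ih fun w hw => hL w (by simp [hw])]
    simp [add_comm]

/-! ### Terms of the operators and transition probabilities -/

/-- The terms of `m Δ_{(1^r, n - r)}` of a permutation in the shuffle algebra. -/
def shuffleTerms {n : ℕ} (r : ℕ) (σ : Equiv.Perm (Fin n)) : List Word :=
  (insertMins r (List.range' 1 (n - r))).map
    (List.map fun x => (permWord σ).getD (x - 1) 0)

/-- The terms of `m Δ_{(1^r, n - r)}` of a permutation in `fqSym`. -/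
def fqSymTerms {n : ℕ} (r : ℕ) (σ : Equiv.Perm (Fin n)) : List Word :=
  insertMins r (std ((permWord σ).drop r))

theorem shuffleAlgebra_refinedComul {n : ℕ} (σ : Equiv.Perm (Fin n)) (D : List ℕ) (hD : D ≠ [])
    (h : D.sum = n) :
    shuffleAlgebra.refinedComul D (Finsupp.single (permWord σ) 1) =
      Finsupp.single (factors id D (permWord σ)) 1 := by
  obtain ⟨d, D, rfl⟩ := List.exists_cons_of_ne_nil hD
  exact ProductCoproduct.refinedComul_single (fun _ => rfl) (fun _ _ => rfl) (fun _ _ => rfl)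
    (fun _ => rfl) rfl D d (by rw [h, length_permWord])

theorem fqSym_refinedComul {n : ℕ} (σ : Equiv.Perm (Fin n)) (D : List ℕ) (hD : D ≠ [])
    (h : D.sum = n) :
    fqSym.refinedComul D (Finsupp.single (permWord σ) 1) =
      Finsupp.single (factors std D (permWord σ)) 1 := by
  obtain ⟨d, D, rfl⟩ := List.exists_cons_of_ne_nil hD
  exact ProductCoproduct.refinedComul_single length_std std_take_std std_drop_std
    (fun _ => rfl) (std_eq_self (permWord_perm σ)) D d (by rw [h, length_permWord])

theorem sum_onesThenRest {n r : ℕ} (hr : r ≤ n) : (onesThenRest n r).sum = n := by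
  unfold onesThenRest
  split_ifs with h
  · simp [h]
  · simp; omega

theorem multinomialCoeff_onesThenRest {n r : ℕ} (hr : r ≤ n) :
    multinomialCoeff (onesThenRest n r) = n.descFactorial r := by
  have hfac := Nat.factorial_mul_descFactorial hr
  have h0 : ((n - r).factorial : ℝ) ≠ 0 := by positivity
  rw [multinomialCoeff, sum_onesThenRest hr]
  have : ((onesThenRest n r).map fun d => (d.factorial : ℝ)).prod = (n - r).factorial := by
    unfold onesThenRest
    split_ifs with h
    · simp
    · simp
  rw [this, ← hfac]
  push_cast
  field_simp

/-- The conventional part `0` for `r = 0` yields an extra empty factor, which acts as a left unit of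
the product. -/
theorem factors_onesThenRest {n r : ℕ} (st : Word → Word) (w : Word) :
    factors st (onesThenRest n r) w =
      (if r = 0 then [st []] else []) ++ factors st (List.replicate r 1 ++ [n - r]) w := by
  unfold onesThenRest
  split_ifs with h
  · simp [h, factors]
  · simp

theorem shuffleAlgebra_mulComul {n r : ℕ} (hr : r ≤ n) (σ : Equiv.Perm (Fin n)) :
    shuffleAlgebra.mulComul (onesThenRest n r) (Finsupp.single (permWord σ) 1) =
      wordSum (shuffleTerms r σ) := by
  rw [ProductCoproduct.mulComul, LinearMap.comp_apply, shuffleAlgebra_refinedComul σ _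
    (by simp [onesThenRest]) (sum_onesThenRest hr), ProductCoproduct.mulMany,
    Finsupp.linearCombination_single, one_smul, factors_onesThenRest]
  have key := shuffleAlgebra_mulWords_factors r (n - r) fun x => (permWord σ).getD (x - 1) 0
  rw [Nat.sub_add_cancel hr, ← permWord_eq_map] at key
  split_ifs with h
  · exact ProductCoproduct.mulWords_nil_cons (sh := fun _ v => v) (fun _ _ => rfl)
      (fun _ => rfl) key
  · exact key

theorem fqSym_mulComul {n r : ℕ} (hr : r ≤ n) (σ : Equiv.Perm (Fin n)) :
    fqSym.mulComul (onesThenRest n r) (Finsupp.single (permWord σ) 1) =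
      wordSum (fqSymTerms r σ) := by
  rw [ProductCoproduct.mulComul, LinearMap.comp_apply, fqSym_refinedComul σ _
    (by simp [onesThenRest]) (sum_onesThenRest hr), ProductCoproduct.mulMany,
    Finsupp.linearCombination_single, one_smul, factors_onesThenRest]
  have key := fqSym_mulWords_factors r (n - r) (permWord σ) (by rw [length_permWord]; omega)
  split_ifs with h
  · exact ProductCoproduct.mulWords_nil_cons (sh := fun s v => v.map (· + s)) (fun _ _ => rfl)
      (fun v => by simp) key
  · exact key

theorem eta_eq_one {H : ProductCoproduct} {st : Word → Word} {n : ℕ} (hn : 0 < n)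
    (σ : Equiv.Perm (Fin n))
    (h : ∀ D : List ℕ, D ≠ [] → D.sum = n → H.refinedComul D (Finsupp.single (permWord σ) 1) =
      Finsupp.single (factors st D (permWord σ)) 1) : H.eta (permWord σ) = 1 := by
  rw [ProductCoproduct.eta, length_permWord, h _ (by simp; omega) (by simp)]
  simp

/-- The distribution that gives probability `a r` to `(1^r, n - r)`. -/
def onesDistribution (n : ℕ) (a : ℕ → ℝ) : List ℕ →₀ ℝ :=
  ∑ r ∈ Finset.range (n + 1), Finsupp.single (onesThenRest n r) (a r)

theorem descentOperator_onesDistribution (H : ProductCoproduct) (n : ℕ) (a : ℕ → ℝ) :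
    H.descentOperator (onesDistribution n a) =
      ∑ r ∈ Finset.range (n + 1),
        (a r / (n.descFactorial r : ℝ)) • H.mulComul (onesThenRest n r) := by
  -- The operator is linear in the distribution, so it can be expanded over `r` without determining
  -- the support.
  have : H.descentOperator (onesDistribution n a) =
      (onesDistribution n a).sum fun D x => (x / multinomialCoeff D) • H.mulComul D := rfl
  rw [this, onesDistribution, ← Finsupp.sum_finsetSum_index (by simp)
    (by intro D x y; rw [add_div, add_smul])]
  refine Finset.sum_congr rfl fun r hr => ?_
  rw [Finsupp.sum_single_index (by simp),
    multinomialCoeff_onesThenRest (by simpa [Nat.lt_succ_iff] using hr)]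

theorem transition_apply {H : ProductCoproduct} {st : Word → Word} {n : ℕ} (hn : 0 < n)
    {terms : ℕ → Equiv.Perm (Fin n) → List Word}
    (h : ∀ σ : Equiv.Perm (Fin n), ∀ D : List ℕ, D ≠ [] → D.sum = n →
      H.refinedComul D (Finsupp.single (permWord σ) 1) =
        Finsupp.single (factors st D (permWord σ)) 1)
    (hterms : ∀ r ≤ n, ∀ σ, H.mulComul (onesThenRest n r) (Finsupp.single (permWord σ) 1) =
      wordSum (terms r σ)) (a : ℕ → ℝ) (σ τ : Equiv.Perm (Fin n)) :
    H.transition (onesDistribution n a) n σ τ =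
      ∑ r ∈ Finset.range (n + 1),
        a r / (n.descFactorial r : ℝ) * ((terms r σ).count (permWord τ) : ℝ) := by
  rw [ProductCoproduct.transition, Matrix.of_apply, eta_eq_one hn σ (h σ), eta_eq_one hn τ (h τ),
    descentOperator_onesDistribution, LinearMap.sum_apply, Finsupp.finsetSum_apply, div_one,
    one_mul]
  refine Finset.sum_congr rfl fun r hr => ?_
  rw [LinearMap.smul_apply, hterms r (by simpa [Nat.lt_succ_iff] using hr), Finsupp.smul_apply,
    wordSum_apply, smul_eq_mul]

theorem shuffleTerms_perm {n r : ℕ} (hr : r ≤ n) (σ : Equiv.Perm (Fin n)) :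
    ∀ w ∈ shuffleTerms r σ, w.Perm (List.range' 1 n) := by
  intro w hw
  obtain ⟨v, hv, rfl⟩ := List.mem_map.1 hw
  have hv' := perm_of_mem_insertMins (List.Perm.refl _) hv
  rw [Nat.sub_add_cancel hr] at hv'
  obtain ⟨τ, rfl⟩ := exists_permWord_eq hv'
  rw [permWord_mul]
  exact permWord_perm _

theorem std_drop_perm {n : ℕ} (r : ℕ) (σ : Equiv.Perm (Fin n)) :
    (std ((permWord σ).drop r)).Perm (List.range' 1 (n - r)) := by
  have hnd : (permWord σ).Nodup := (permWord_perm σ).nodup_iff.2 List.nodup_range'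
  simpa [length_permWord] using std_perm (hnd.sublist (List.drop_sublist r _))

theorem fqSymTerms_perm {n r : ℕ} (hr : r ≤ n) (σ : Equiv.Perm (Fin n)) :
    ∀ w ∈ fqSymTerms r σ, w.Perm (List.range' 1 n) := by
  intro w hw
  have := perm_of_mem_insertMins (std_drop_perm r σ) hw
  rwa [Nat.sub_add_cancel hr] at this

theorem length_shuffleTerms {n r : ℕ} (hr : r ≤ n) (σ : Equiv.Perm (Fin n)) :
    (shuffleTerms r σ).length = n.descFactorial r := by
  simp [shuffleTerms, length_insertMins, Nat.sub_add_cancel hr]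

theorem length_fqSymTerms {n r : ℕ} (hr : r ≤ n) (σ : Equiv.Perm (Fin n)) :
    (fqSymTerms r σ).length = n.descFactorial r := by
  simp [fqSymTerms, length_insertMins, length_std, length_permWord, Nat.sub_add_cancel hr]

/-- The terms of `σ` are the products of `σ` with a fixed list of permutations, so left
multiplication by `ρ` only renames them. This is the left invariance of the unstandardised chain. -/
theorem shuffleTerms_count {n r : ℕ} (hr : r ≤ n) (ρ σ τ : Equiv.Perm (Fin n)) :
    (shuffleTerms r (ρ * σ)).count (permWord (ρ * τ)) = (shuffleTerms r σ).count (permWord τ) := by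
  have hP : ∀ L : List Word, (∀ w ∈ L, w.Perm (List.range' 1 n)) →
      ∃ P : List (Equiv.Perm (Fin n)), P.map permWord = L := by
    intro L hL
    induction L with
    | nil => exact ⟨[], rfl⟩
    | cons w L ih =>
      obtain ⟨π, rfl⟩ := exists_permWord_eq (hL w (by simp))
      obtain ⟨P, rfl⟩ := ih fun w hw => hL w (by simp [hw])
      exact ⟨π :: P, rfl⟩
  obtain ⟨P, hP⟩ := hP (insertMins r (List.range' 1 (n - r))) fun w hw => by
    have := perm_of_mem_insertMins (List.Perm.refl _) hw
    rwa [Nat.sub_add_cancel hr] at this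
  have key : ∀ α : Equiv.Perm (Fin n), shuffleTerms r α = (P.map (α * ·)).map permWord := by
    intro α
    rw [shuffleTerms, ← hP, List.map_map, List.map_map]
    exact List.map_congr_left fun π _ => permWord_mul α π
  rw [key, key, List.count_map_of_injective _ _ permWord_injective,
    List.count_map_of_injective _ _ permWord_injective]
  have : P.map (ρ * σ * ·) = (P.map (σ * ·)).map (ρ * ·) := by
    simp [Function.comp_def, mul_assoc]
  rw [this, List.count_map_of_injective _ _ (mul_right_injective ρ)]

/-! ### One-step averages for the two algebras -/

/-- The positions `j, j + 1, …`. -/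
def tailPos (N j : ℕ) : Fin N → ℕ := fun l => j + l

theorem sum_fqSymTerms {N j r : ℕ} (hr : r ≤ N + j) (k : Fin N) (σ : Equiv.Perm (Fin (N + j))) :
    ((fqSymTerms r σ).map (minAt (tailPos N j) k)).sum =
      (j.descFactorial r : ℝ) * minAt (tailPos N j) k (permWord σ) +
        (((N + j).descFactorial r : ℝ) - j.descFactorial r) / N := by
  have hm : N + j - r + r = N + j := Nat.sub_add_cancel hr
  have h := sum_insertMins (std_drop_perm r σ) k (minAt (tailPos N j) k (permWord σ))
    -- The invariant says that `p` enumerates the last `N` positions of a word of length `m`. An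
    -- insertion avoiding them lies before all of them, so they pull back to the last `N` positions,
    -- and finally to those of the remainder of `σ`.
    (fun m p => N ≤ m ∧ ∀ l, p l + N = m + l) ?_ ?_ r j hm (tailPos N j)
    (fun a b h => Fin.ext (by simpa [tailPos] using h))
    (fun l => by simp only [tailPos]; omega)
    ⟨by omega, fun l => by simp only [tailPos]; omega⟩
  · rwa [hm] at h
  · rintro m p i ⟨hm1, hp⟩ hi hne
    have hlt : i + N < m + 1 := by
      by_contra! hcon
      -- If `i` were one of the last `N` positions, this would be its index.
      have h1 := hp ⟨i + N - (m + 1), by omega⟩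
      have h2 := hne ⟨i + N - (m + 1), by omega⟩
      simp only at h1
      omega
    refine ⟨by omega, fun l => ?_⟩
    have := hp l
    unfold shiftPos
    split_ifs <;> omega
  · rintro p ⟨hm1, hp⟩
    rw [std.eq_def, minAt_map (fun l => ?_) k fun a ha b _ => rank_le_rank_iff ha]
    · have : ∀ l, ((permWord σ).drop r).getD (p l) 0 = (permWord σ).getD (tailPos N j l) 0 := by
        intro l
        have h1 := hp l
        have h2 : r + p l = tailPos N j l := by simp only [tailPos]; omega
        simp [List.getD_eq_getElem?_getD, h2]
      simp only [minAt, this]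
    · have := hp l
      rw [List.length_drop, length_permWord]
      omega

theorem shuffleTerms_one {n r : ℕ} (hr : r ≤ n) :
    shuffleTerms r (1 : Equiv.Perm (Fin n)) = insertMins r (List.range' 1 (n - r)) := by
  rw [shuffleTerms]
  conv_rhs => rw [← List.map_id (insertMins r (List.range' 1 (n - r)))]
  refine List.map_congr_left fun w hw => ?_
  have hw' := perm_of_mem_insertMins (List.Perm.refl _) hw
  rw [Nat.sub_add_cancel hr] at hw'
  obtain ⟨τ, rfl⟩ := exists_permWord_eq hw'
  rw [permWord_mul, one_mul, id]

theorem permWord_tail {N j : ℕ} (σ : Equiv.Perm (Fin (N + j))) (l : Fin N) :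
    (permWord σ).getD (tailPos N j l) 0 = (σ ⟨j + l, by omega⟩ : ℕ) + 1 :=
  permWord_getD σ ⟨j + l, by omega⟩

/-- For fixed `τ` this turns the event for the product into one about `ρ` alone, at positions given
by `τ`. -/
theorem minAt_permWord_mul {N j : ℕ} (k : Fin N) (ρ τ : Equiv.Perm (Fin (N + j))) :
    minAt (tailPos N j) k (permWord (ρ * τ)) =
      minAt (fun l : Fin N => (τ ⟨j + l, by omega⟩ : ℕ)) k (permWord ρ) := by
  simp only [minAt, permWord_tail, permWord_getD, Equiv.Perm.mul_apply]

theorem sum_shuffleTerms {N j r : ℕ} (hr : r ≤ N + j) (k : Fin N) (τ : Equiv.Perm (Fin (N + j))) :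
    ((shuffleTerms r (1 : Equiv.Perm (Fin (N + j)))).map
        (minAt (fun l : Fin N => (τ ⟨j + l, by omega⟩ : ℕ)) k)).sum =
      (j.descFactorial r : ℝ) * minAt (tailPos N j) k (permWord τ) +
        (((N + j).descFactorial r : ℝ) - j.descFactorial r) / N := by
  have hm : N + j - r + r = N + j := Nat.sub_add_cancel hr
  set q : Fin N → ℕ := fun l : Fin N => (τ ⟨j + l, by omega⟩ : ℕ) with hq
  have hinj : Function.Injective q := by
    intro a b h
    have := τ.injective (Fin.ext h)
    simp only [Fin.mk.injEq] at this
    exact Fin.ext (by omega)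
  have hlt : ∀ l, q l < N + j - r + r := fun l => by simp only [hq]; omega
  have h := sum_insertMins (List.Perm.refl (List.range' 1 (N + j - r))) k
    (minAt (tailPos N j) k (permWord τ))
    -- Pulling back past an avoided place preserves the order of the positions. In the identity word
    -- letters increase with position, so at the start the comparison is that of the values `q`,
    -- which are the letters of `τ` less one.
    (fun m p => (∀ l, p l < m) ∧ ((∀ l, p k ≤ p l) ↔ ∀ l, q k ≤ q l)) ?_ ?_ r j hm q
    hinj hlt ⟨hlt, Iff.rfl⟩
  · rwa [hm, ← shuffleTerms_one hr] at h
  · rintro m p i ⟨hp, hC⟩ hi hne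
    refine ⟨fun l => ?_, ?_⟩
    · have := hp l
      have := hne l
      unfold shiftPos
      split_ifs <;> omega
    · rw [← hC]
      refine forall_congr' fun l => ?_
      have := hne l
      have := hne k
      unfold shiftPos
      split_ifs <;> omega
  · rintro p ⟨hp, hC⟩
    have hval : ∀ l, (List.range' 1 (N + j - r)).getD (p l) 0 = p l + 1 := fun l => by
      rw [List.getD_eq_getElem _ _ (by simpa using hp l)]
      simp [add_comm]
    unfold minAt
    refine if_congr ?_ rfl rfl
    simp only [hval, permWord_tail, Nat.add_le_add_iff_right]
    exact hC

/-! ### The event as an indicator and the recurrence for its probability -/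

theorem probAfter_smallestAt {N j : ℕ} (k : Fin N)
    (K : Matrix (Equiv.Perm (Fin (N + j))) (Equiv.Perm (Fin (N + j))) ℝ) (t : ℕ) :
    probAfter K t (smallestAt j ⟨j + k, by omega⟩) =
      ∑ σ, (K ^ t) 1 σ * minAt (tailPos N j) k (permWord σ) := by
  refine Finset.sum_congr rfl fun σ _ => ?_
  have hmem : σ ∈ smallestAt j ⟨j + k, by omega⟩ ↔
      ∀ l, (permWord σ).getD (tailPos N j k) 0 ≤ (permWord σ).getD (tailPos N j l) 0 := by
    simp only [permWord_tail, Nat.add_le_add_iff_right, Fin.val_fin_le, smallestAt,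
      Set.mem_ofPred_eq, IsLeast, mem_lowerBounds, Set.forall_mem_image]
    constructor
    · rintro ⟨-, h⟩ l
      exact h (show j ≤ j + (l : ℕ) by omega)
    · refine fun h => ⟨Set.mem_image_of_mem _ (show j ≤ j + (k : ℕ) by omega), fun i hi => ?_⟩
      have hi' : j ≤ (i : ℕ) := hi
      have := h ⟨i - j, by omega⟩
      have hidx : (⟨j + (i - j), by omega⟩ : Fin (N + j)) = i := Fin.ext (by simp only; omega)
      rwa [hidx] at this
  by_cases h : σ ∈ smallestAt j ⟨j + k, by omega⟩
  · rw [Set.indicator_of_mem h, minAt, if_pos (hmem.1 h), mul_one]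
  · rw [Set.indicator_of_notMem h, minAt, if_neg fun h' => h (hmem.2 h'), mul_zero]

theorem minAt_permWord_one {N j : ℕ} (k : Fin N) :
    minAt (tailPos N j) k (permWord (1 : Equiv.Perm (Fin (N + j)))) =
      if (k : ℕ) = 0 then 1 else 0 := by
  unfold minAt
  refine if_congr ?_ rfl rfl
  simp only [permWord_tail, Equiv.Perm.one_apply]
  constructor
  · intro h
    have := h ⟨0, k.pos⟩
    simp only at this
    omega
  · intro h l
    omega

/-- The fixed point is `1 / N`, and the deviation from it is multiplied by `β` at each step. Here
`k` counts from `0`, hence `k + 1` in the law. -/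
theorem smallestLaw_of_recurrence {N j : ℕ} (k : Fin N) (β : ℝ) (x : ℕ → ℝ)
    (h0 : x 0 = if (k : ℕ) = 0 then 1 else 0)
    (hs : ∀ t, x (t + 1) = β * x t + (1 - β) / N) (t : ℕ) :
    x t = smallestLaw (N + j) j (k + 1) t β := by
  have hN : (N : ℝ) ≠ 0 := by
    have := k.pos
    positivity
  have hx : x t = β ^ t * x 0 + (1 - β ^ t) / N := by
    induction t with
    | zero => simp
    | succ t ih => rw [hs, ih]; field_simp; ring
  rw [hx, h0, smallestLaw]
  by_cases hk : (k : ℕ) = 0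
  · simp [hk]; field_simp; ring
  · simp [hk]; field_simp

/-! ### The two Markov chains -/

section

variable {N j : ℕ} {a : ℕ → ℝ} {β : ℝ}

theorem sum_weights (k : Fin N) (ha : ∑ r ∈ Finset.range (N + j + 1), a r = 1)
    (hβ : ∑ r ∈ Finset.range (N + j + 1),
      a r * ((j.descFactorial r : ℝ) / (N + j).descFactorial r) = β) (c : ℝ) :
    ∑ r ∈ Finset.range (N + j + 1), a r / ((N + j).descFactorial r : ℝ) *
      ((j.descFactorial r : ℝ) * c +
        (((N + j).descFactorial r : ℝ) - j.descFactorial r) / N) = β * c + (1 - β) / N := by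
  rw [← ha, ← hβ, ← Finset.sum_sub_distrib, Finset.sum_mul, Finset.sum_div,
    ← Finset.sum_add_distrib]
  refine Finset.sum_congr rfl fun r hr => ?_
  have hd : ((N + j).descFactorial r : ℝ) ≠ 0 := by
    rw [Finset.mem_range] at hr
    exact_mod_cast (Nat.descFactorial_pos.2 (by omega)).ne'
  have hN : (N : ℝ) ≠ 0 := by
    have := k.pos
    positivity
  field_simp

theorem row_sum {n : ℕ} {K : Matrix (Equiv.Perm (Fin n)) (Equiv.Perm (Fin n)) ℝ}
    {terms : ℕ → Equiv.Perm (Fin n) → List Word}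
    (hK : ∀ σ τ, K σ τ = ∑ r ∈ Finset.range (n + 1),
      a r / (n.descFactorial r : ℝ) * ((terms r σ).count (permWord τ) : ℝ))
    (hperm : ∀ r ≤ n, ∀ σ, ∀ w ∈ terms r σ, w.Perm (List.range' 1 n))
    (f : Word → ℝ) (σ : Equiv.Perm (Fin n)) :
    ∑ τ, K σ τ * f (permWord τ) = ∑ r ∈ Finset.range (n + 1),
      a r / (n.descFactorial r : ℝ) * ((terms r σ).map f).sum := by
  simp only [hK, Finset.sum_mul]
  rw [Finset.sum_comm]
  refine Finset.sum_congr rfl fun r hr => ?_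
  rw [Finset.mem_range, Nat.lt_succ_iff] at hr
  rw [← sum_count_permWord _ (hperm r hr σ), Finset.mul_sum]
  simp only [mul_assoc]

theorem row_sum_eq_one {n : ℕ} {K : Matrix (Equiv.Perm (Fin n)) (Equiv.Perm (Fin n)) ℝ}
    {terms : ℕ → Equiv.Perm (Fin n) → List Word}
    (hK : ∀ σ τ, K σ τ = ∑ r ∈ Finset.range (n + 1),
      a r / (n.descFactorial r : ℝ) * ((terms r σ).count (permWord τ) : ℝ))
    (hperm : ∀ r ≤ n, ∀ σ, ∀ w ∈ terms r σ, w.Perm (List.range' 1 n))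
    (hlen : ∀ r ≤ n, ∀ σ, (terms r σ).length = n.descFactorial r)
    (ha : ∑ r ∈ Finset.range (n + 1), a r = 1) (σ : Equiv.Perm (Fin n)) :
    ∑ τ, K σ τ = 1 := by
  have h := row_sum hK hperm (fun _ => 1) σ
  simp only [mul_one] at h
  rw [h]
  refine Eq.trans ?_ ha
  refine Finset.sum_congr rfl fun r hr => ?_
  rw [Finset.mem_range, Nat.lt_succ_iff] at hr
  have hd : (n.descFactorial r : ℝ) ≠ 0 := by
    exact_mod_cast (Nat.descFactorial_pos.2 hr).ne'
  simp [hlen r hr]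
  field_simp

theorem sum_pow_eq_one {ι : Type*} [Fintype ι] [DecidableEq ι] {K : Matrix ι ι ℝ}
    (hK : ∀ σ, ∑ τ, K σ τ = 1) (t : ℕ) (σ : ι) : ∑ τ, (K ^ t) σ τ = 1 := by
  induction t with
  | zero => simp [Matrix.one_apply]
  | succ t ih =>
    simp only [pow_succ, Matrix.mul_apply]
    rw [Finset.sum_comm]
    simp only [← Finset.mul_sum, hK, mul_one, ih]

theorem probAfter_fqSym (k : Fin N) (ha : ∑ r ∈ Finset.range (N + j + 1), a r = 1)
    (hβ : ∑ r ∈ Finset.range (N + j + 1),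
      a r * ((j.descFactorial r : ℝ) / (N + j).descFactorial r) = β) (t : ℕ) :
    probAfter (fqSym.transition (onesDistribution (N + j) a) (N + j)) t
      (smallestAt j ⟨j + k, by omega⟩) = smallestLaw (N + j) j (k + 1) t β := by
  have hK := transition_apply (n := N + j) (by have := k.pos; omega) fqSym_refinedComul
    (fun r hr σ => fqSym_mulComul hr σ) a
  set K := fqSym.transition (onesDistribution (N + j) a) (N + j)
  have hperm : ∀ r ≤ N + j, ∀ σ : Equiv.Perm (Fin (N + j)), ∀ w ∈ fqSymTerms r σ,
    w.Perm (List.range' 1 (N + j)) := fun r hr σ => fqSymTerms_perm hr σ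
  have hone := row_sum_eq_one hK hperm (fun r hr σ => length_fqSymTerms hr σ) ha
  rw [probAfter_smallestAt]
  refine smallestLaw_of_recurrence k β
    (fun t => ∑ σ, (K ^ t) 1 σ * minAt (tailPos N j) k (permWord σ)) ?_ (fun t => ?_) t
  · simp [Matrix.one_apply, minAt_permWord_one]
  -- The indicator is mapped by the transition matrix to an affine function of itself, so
  -- conditioning on the state before the last step gives the recurrence.
  · have hstep : ∀ σ, ∑ τ, K σ τ * minAt (tailPos N j) k (permWord τ) =
        β * minAt (tailPos N j) k (permWord σ) + (1 - β) / N := by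
      intro σ
      rw [row_sum hK hperm, ← sum_weights k ha hβ]
      refine Finset.sum_congr rfl fun r hr => ?_
      rw [Finset.mem_range, Nat.lt_succ_iff] at hr
      rw [sum_fqSymTerms hr]
    simp only [pow_succ, Matrix.mul_apply, Finset.sum_mul]
    rw [Finset.sum_comm]
    simp only [mul_assoc, ← Finset.mul_sum, hstep, mul_add, Finset.sum_add_distrib]
    rw [← Finset.sum_mul, sum_pow_eq_one hone, one_mul, Finset.mul_sum]
    congr 1
    exact Finset.sum_congr rfl fun σ _ => by ring

theorem pow_mul_left_invariant {G : Type*} [Group G] [Fintype G] [DecidableEq G]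
    {K : Matrix G G ℝ} (hK : ∀ ρ σ τ, K (ρ * σ) (ρ * τ) = K σ τ) (t : ℕ) (ρ σ τ : G) :
    (K ^ t) (ρ * σ) (ρ * τ) = (K ^ t) σ τ := by
  induction t generalizing τ with
  | zero => simp [Matrix.one_apply]
  | succ t ih =>
    simp only [pow_succ, Matrix.mul_apply]
    rw [← Equiv.sum_comp (Equiv.mulLeft ρ)]
    simp [ih, hK]

theorem probAfter_shuffleAlgebra (k : Fin N) (ha : ∑ r ∈ Finset.range (N + j + 1), a r = 1)
    (hβ : ∑ r ∈ Finset.range (N + j + 1),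
      a r * ((j.descFactorial r : ℝ) / (N + j).descFactorial r) = β) (t : ℕ) :
    probAfter (shuffleAlgebra.transition (onesDistribution (N + j) a) (N + j)) t
      (smallestAt j ⟨j + k, by omega⟩) = smallestLaw (N + j) j (k + 1) t β := by
  have hK := transition_apply (n := N + j) (by have := k.pos; omega) shuffleAlgebra_refinedComul
    (fun r hr σ => shuffleAlgebra_mulComul hr σ) a
  set K := shuffleAlgebra.transition (onesDistribution (N + j) a) (N + j)
  have hperm : ∀ r ≤ N + j, ∀ σ : Equiv.Perm (Fin (N + j)), ∀ w ∈ shuffleTerms r σ,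
    w.Perm (List.range' 1 (N + j)) := fun r hr σ => shuffleTerms_perm hr σ
  have hone := row_sum_eq_one hK hperm (fun r hr σ => length_shuffleTerms hr σ) ha
  have hinv : ∀ ρ σ τ, K (ρ * σ) (ρ * τ) = K σ τ := by
    intro ρ σ τ
    rw [hK, hK]
    refine Finset.sum_congr rfl fun r hr => ?_
    rw [Finset.mem_range, Nat.lt_succ_iff] at hr
    rw [shuffleTerms_count hr]
  rw [probAfter_smallestAt]
  refine smallestLaw_of_recurrence k β
    (fun t => ∑ σ, (K ^ t) 1 σ * minAt (tailPos N j) k (permWord σ)) ?_ (fun t => ?_) t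
  · simp [Matrix.one_apply, minAt_permWord_one]
  -- Here the average is over the first step `ρ` from the identity, with the later movement `τ` held
  -- fixed.
  · have hstep : ∀ τ, ∑ ρ, K 1 ρ * minAt (tailPos N j) k (permWord (ρ * τ)) =
        β * minAt (tailPos N j) k (permWord τ) + (1 - β) / N := by
      intro τ
      simp only [minAt_permWord_mul]
      rw [row_sum hK hperm, ← sum_weights k ha hβ]
      refine Finset.sum_congr rfl fun r hr => ?_
      rw [Finset.mem_range, Nat.lt_succ_iff] at hr
      rw [sum_shuffleTerms hr]
    have hpow : ∀ ρ τ, (K ^ t) ρ (ρ * τ) = (K ^ t) 1 τ := fun ρ τ => by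
      simpa using pow_mul_left_invariant hinv t ρ 1 τ
    -- The substitution `σ = ρ * τ` and left invariance make the weight of the last `t` steps
    -- independent of `ρ`.
    have hreindex : ∀ ρ, ∑ σ, K 1 ρ * (K ^ t) ρ σ * minAt (tailPos N j) k (permWord σ) =
        ∑ τ, (K ^ t) 1 τ * (K 1 ρ * minAt (tailPos N j) k (permWord (ρ * τ))) := fun ρ => by
      rw [← Equiv.sum_comp (Equiv.mulLeft ρ)]
      refine Finset.sum_congr rfl fun τ _ => ?_
      rw [Equiv.coe_mulLeft, hpow]
      ring
    -- `pow_succ'` splits off the first step rather than the last.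
    simp only [pow_succ', Matrix.mul_apply, Finset.sum_mul]
    rw [Finset.sum_comm]
    simp only [hreindex]
    rw [Finset.sum_comm]
    simp only [← Finset.mul_sum, hstep, mul_add, Finset.sum_add_distrib]
    rw [← Finset.sum_mul, sum_pow_eq_one hone, one_mul, Finset.mul_sum]
    congr 1
    exact Finset.sum_congr rfl fun σ _ => by ring

end

/-! ### The eigenvalues of the two distributions -/

theorem topToRandom_eq {n : ℕ} (hn : 0 < n) :
    topToRandom n = onesDistribution n fun r => if r = 1 then 1 else 0 := by
  rw [topToRandom, onesDistribution, Finset.sum_eq_single 1]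
  · simp [onesThenRest]
  · intro r _ hr
    simp [hr]
  · intro h
    simp at h
    omega

theorem sum_binomial_weights {n : ℕ} (q : ℝ) :
    ∑ r ∈ Finset.range (n + 1), (n.choose r : ℝ) * (1 - q) ^ r * q ^ (n - r) = 1 := by
  have h := add_pow (1 - q) q n
  rw [sub_add_cancel, one_pow] at h
  refine Eq.trans (Finset.sum_congr rfl fun r _ => ?_) h.symm
  ring

/-- Cancelling `r!` turns `(N + j).choose r` times the ratio of falling factorials into `j.choose
r`. The terms with `r > j` vanish, and after extracting `q ^ N` the binomial theorem for exponent
`j` leaves `1`. -/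
theorem sum_binomial_weights_mul {N j : ℕ} (q : ℝ) :
    ∑ r ∈ Finset.range (N + j + 1),
      ((N + j).choose r : ℝ) * (1 - q) ^ r * q ^ (N + j - r) *
        ((j.descFactorial r : ℝ) / (N + j).descFactorial r) = q ^ N := by
  have hterm : ∀ r ∈ Finset.range (N + j + 1),
      ((N + j).choose r : ℝ) * (1 - q) ^ r * q ^ (N + j - r) *
        ((j.descFactorial r : ℝ) / (N + j).descFactorial r) =
      (j.choose r : ℝ) * (1 - q) ^ r * q ^ (N + j - r) := by
    intro r hr
    rw [Finset.mem_range] at hr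
    have hc : ((N + j).choose r : ℝ) ≠ 0 := by
      exact_mod_cast (Nat.choose_pos (by omega)).ne'
    rw [Nat.descFactorial_eq_factorial_mul_choose, Nat.descFactorial_eq_factorial_mul_choose]
    push_cast
    field_simp
  rw [Finset.sum_congr rfl hterm,
    ← Finset.sum_subset (s₁ := Finset.range (j + 1)) (by intro; simp; omega)]
  · refine Eq.trans ?_
      (congrArg (q ^ N * ·) (sum_binomial_weights (n := j) q) |>.trans (mul_one _))
    rw [Finset.mul_sum]
    refine Finset.sum_congr rfl fun r hr => ?_
    rw [Finset.mem_range] at hr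
    rw [Nat.add_sub_assoc (by omega), pow_add]
    ring
  · intro r _ hr
    rw [Nat.choose_eq_zero_of_lt (by simpa using hr)]
    simp

end DescentChain

end

theorem corollary6p6 (n j k t : ℕ) (hk : 1 ≤ k) (hjk : j + k ≤ n) :
    (∀ H ∈ ({DescentChain.shuffleAlgebra, DescentChain.fqSym} :
          Set DescentChain.ProductCoproduct),
      DescentChain.probAfter (H.transition (DescentChain.topToRandom n) n) t
          (DescentChain.smallestAt j ⟨j + k - 1, by omega⟩)
        = DescentChain.smallestLaw n j k t ((j : ℝ) / n)) ∧
    (∀ q₂ : ℝ, 0 ≤ q₂ → q₂ ≤ 1 →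
      ∀ H ∈ ({DescentChain.shuffleAlgebra, DescentChain.fqSym} :
          Set DescentChain.ProductCoproduct),
        DescentChain.probAfter (H.transition (DescentChain.binomialTopToRandom n q₂) n) t
            (DescentChain.smallestAt j ⟨j + k - 1, by omega⟩)
          = DescentChain.smallestLaw n j k t (q₂ ^ (n - j))) := by
  -- `N` is the number of compared positions; the next line makes the index `k` start from `0`.
  obtain ⟨N, rfl⟩ : ∃ N, n = N + j := ⟨n - j, by omega⟩
  obtain ⟨k, rfl⟩ : ∃ k', k = k' + 1 := ⟨k - 1, by omega⟩
  have hkN : k < N := by omega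
  have key : ∀ (a : ℕ → ℝ) (β : ℝ), ∑ r ∈ Finset.range (N + j + 1), a r = 1 →
      ∑ r ∈ Finset.range (N + j + 1),
        a r * ((j.descFactorial r : ℝ) / (N + j).descFactorial r) = β →
      ∀ H ∈ ({DescentChain.shuffleAlgebra, DescentChain.fqSym} :
          Set DescentChain.ProductCoproduct),
        DescentChain.probAfter
            (H.transition (DescentChain.onesDistribution (N + j) a) (N + j)) t
            (DescentChain.smallestAt j ⟨j + (k + 1) - 1, by omega⟩)
          = DescentChain.smallestLaw (N + j) j (k + 1) t β := by
    rintro a β ha hβ H (rfl | rfl)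
    · exact DescentChain.probAfter_shuffleAlgebra ⟨k, hkN⟩ ha hβ t
    · exact DescentChain.probAfter_fqSym ⟨k, hkN⟩ ha hβ t
  refine ⟨?_, fun q _ _ => ?_⟩
  · rw [DescentChain.topToRandom_eq (by omega)]
    refine key _ _ ?_ ?_
    · simp
      omega
    · rw [Finset.sum_eq_single 1]
      · simp
      · intro r _ hr
        simp [hr]
      · intro h
        simp at h
        omega
  · refine key _ _ (DescentChain.sum_binomial_weights q) ?_
    rw [Nat.add_sub_cancel]
    exact DescentChain.sum_binomial_weights_mul q
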